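/- Let $(\Omega,\mathcal F,\mathbb P)$ be an atomless probability space, let $L^1$ be the set of random variables $X:\Omega\to\mathbb R$ with finite mean, and let $\underline{L}^1$ be the set of those $X\in L^1$ that are essentially bounded from below. For a random variable $X$ and $\alpha\in[0,1]$ put $$\mathrm{VaR}_\alpha(X)=\inf\{x\in\mathbb R:\mathbb P(X\le x)\ge\alpha\},\qquad \mathrm{VaR}^+_\alpha(X)=\inf\{x\in\mathbb R:\mathbb P(X\le x)>\alpha\},$$ with values in $\overline{\mathbb R}=[-\infty,\infty]$, and for $X\in L^1$ put $$\mathrm{ES}_\alpha(X)=\frac1{1-\alpha}\int_\alpha^1\mathrm{VaR}_\beta(X)\,\mathrm d\beta\ \text{ for }\alpha\in[0,1),\qquad \mathrm{ES}_1(X)=\mathrm{VaR}_1(X).$$ Let $\mathcal X$ be $L^1$ or $\underline{L}^1$. A mapping $\rho:\mathcal X\to\overline{\mathbb R}$ is called quasi-convex if $\rho(\gamma X+(1-\gamma)Y)\le\max\{\rho(X),\rho(Y)\}$ for all $X,Y\in\mathcal X$ and $\gamma\in[0,1]$, and law invariant if $\rho(X)=\rho(Y)$ whenever $X,Y\in\mathcal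 X$ have the same distribution. Inequalities and minima of mappings are pointwise: $\rho\ge\nu$ means $\rho(X)\ge\nu(X)$ for all $X\in\mathcal X$, and the minimum of a set of mappings is an element of the set that is $\le$ every element of it. For every $\alpha\in(0,1]$, $$\mathrm{ES}_\alpha=\min\{\rho:L^1\to\overline{\mathbb R}\mid \rho\ge\mathrm{VaR}_\alpha\text{ and }\rho\text{ is quasi-convex and law invariant}\}.$$ For every $\alpha\in(0,1)$, $$\mathrm{ES}_\alpha=\min\{\rho:L^1\to\overline{\mathbb R}\mid \rho\ge\mathrm{VaR}^+_\alpha\text{ and }\rho\text{ is quasi-convex and law invariant}\}.$$ For every $\alpha\in[0,1)$, with $\mathrm{ES}_\alpha$ restricted to $\underline{L}^1$, $$\mathrm{ES}_\alpha=\min\{\rho:\underline{L}^1\to\overline{\mathbb R}\mid \rho\ge\mathrm{VaR}^+_\alpha\text{ and }\rho\text{ is quasi-convex and law invariant}\}.$$ -/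

import Mathlib

noncomputable section

open MeasureTheory ProbabilityTheory Set

namespace RiskMeasure

variable {Ω : Type*} [MeasurableSpace Ω]

/-- A measure is atomless if every measurable set of positive measure has a measurable subset of
strictly smaller positive measure. (On a general measurable space this is stronger than asking that
singletons are null.) -/
def Atomless (P : Measure Ω) : Prop :=
  ∀ A : Set Ω, MeasurableSet A → 0 < P A →
    ∃ B : Set Ω, B ⊆ A ∧ MeasurableSet B ∧ 0 < P B ∧ P B < P A

/-- The random variables with finite mean. -/
def L1 (P : Measure Ω) : Set (Ω → ℝ) :=
  {X | Measurable X ∧ Integrable X P}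

/-- The random variables with finite mean that are essentially bounded from below. -/
def L1BddBelow (P : Measure Ω) : Set (Ω → ℝ) :=
  {X | X ∈ L1 P ∧ ∃ c : ℝ, ∀ᵐ ω ∂P, c ≤ X ω}

/-- The left quantile `inf {x ∈ ℝ : P(X ≤ x) ≥ α}`, with infimum in `[-∞, ∞]`. -/
def VaR (P : Measure Ω) (α : ℝ) (X : Ω → ℝ) : EReal :=
  sInf ((fun x : ℝ => (x : EReal)) '' {x : ℝ | α ≤ P.real {ω | X ω ≤ x}})

/-- The right quantile `inf {x ∈ ℝ : P(X ≤ x) > α}`, with infimum in `[-∞, ∞]`. -/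
def VaRPlus (P : Measure Ω) (α : ℝ) (X : Ω → ℝ) : EReal :=
  sInf ((fun x : ℝ => (x : EReal)) '' {x : ℝ | α < P.real {ω | X ω ≤ x}})

/-- Expected Shortfall: `(1 - α)⁻¹ ∫_α^1 VaR_β(X) dβ` for `α < 1`, and `VaR_1(X)` at level `1`.
For `0 < β < 1` the value `VaR_β(X)` is a real number, so that `EReal.toReal` changes the integrand
at most at the endpoints; for `X` with finite mean the integral converges absolutely. -/
def ES (P : Measure Ω) (α : ℝ) (X : Ω → ℝ) : EReal :=
  if α < 1 then (((1 - α)⁻¹ * ∫ β in α..1, (VaR P β X).toReal : ℝ) : EReal) else VaR P 1 X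

/-- Quasi-convexity of a risk measure on a space `𝒳` of random variables (`Z` names the convex
combination as an element of `𝒳`; it always exists when `𝒳` is convex). -/
def IsQuasiConvex {𝒳 : Set (Ω → ℝ)} (ρ : 𝒳 → EReal) : Prop :=
  ∀ (X Y Z : 𝒳) (γ : ℝ), γ ∈ Icc (0 : ℝ) 1 →
    (Z : Ω → ℝ) = γ • (X : Ω → ℝ) + (1 - γ) • (Y : Ω → ℝ) → ρ Z ≤ max (ρ X) (ρ Y)

/-- Law invariance: random variables in `𝒳` with the same distribution get the same value. -/
def IsLawInvariant (P : Measure Ω) {𝒳 : Set (Ω → ℝ)} (ρ : 𝒳 → EReal) : Prop :=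
  ∀ X Y : 𝒳, IdentDistrib (X : Ω → ℝ) (Y : Ω → ℝ) P P → ρ X = ρ Y

/-- The quasi-convex and law-invariant risk measures `ρ : 𝒳 → [-∞, ∞]` that dominate `ν` on `𝒳`. -/
def dominating (P : Measure Ω) (𝒳 : Set (Ω → ℝ)) (ν : (Ω → ℝ) → EReal) : Set (𝒳 → EReal) :=
  {ρ | (∀ X : 𝒳, ν X ≤ ρ X) ∧ IsQuasiConvex ρ ∧ IsLawInvariant P ρ}

end RiskMeasure

end

noncomputable section

open MeasureTheory ProbabilityTheory Set Filter Topology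

namespace RiskMeasure

variable {Ω : Type*} [MeasurableSpace Ω]

/-! `ES` averages `VaR` over levels above α, so it dominates `VaRPlus` at α. It is law invariant by
construction and, for α < 1, convex by the Rockafellar–Uryasev formula: (1 - α) `ES` is the minimum
over t of (1 - α)t + E(X - t)⁺, attained for α > 0; α = 0 gives the mean.

For minimality, let q be the quantile function of X and U a uniform variable, which exists by
`exists_uniform`. Rotating the tail [α, 1) of U in N equal steps before applying q gives N variables
with the law of X. Quasi-convexity and law invariance give ρ(Z) ≤ ρ(X) for their average Z. On {U ∈
[α, 1)}, of probability 1 - α, Z is at least the lower Riemann sum of the mean of q over [α, 1),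
hence so are `VaRPlus` of Z at α and ρ(X) (`lowerSum_le_of_mem_dominating`). Letting N → ∞ gives
`ES` ≤ ρ. The sum contains q(α), which for α = 0 is finite only if X is bounded below. A ρ
dominating `VaR` at α < 1 dominates `VaRPlus` at every β < α, and β ↑ α concludes. -/

/-! ### Maximal chains of measurable sets in an atomless space -/

/-- Inclusion of measurable sets up to a null set. -/
def AESubset (P : Measure Ω) (A B : {A : Set Ω // MeasurableSet A}) : Prop :=
  A.1 ≤ᵐ[P] B.1

lemma AESubset.trans {P : Measure Ω} {A B C : {A : Set Ω // MeasurableSet A}}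
    (h : AESubset P A B) (h' : AESubset P B C) : AESubset P A C :=
  Filter.EventuallyLE.trans h h'

lemma AESubset.of_subset {P : Measure Ω} {A B : {A : Set Ω // MeasurableSet A}}
    (h : A.1 ⊆ B.1) : AESubset P A B :=
  Filter.Eventually.of_forall h

lemma mem_maxChain_of_comparable {α : Type*} {r : α → α → Prop} {C : Set α}
    (hC : IsMaxChain r C) {b : α} (h : ∀ d ∈ C, r b d ∨ r d b) : b ∈ C := by
  have h1 : IsChain r (insert b C) := hC.1.insert fun d hd _ => h d hd
  rw [hC.2 h1 (subset_insert b C)]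
  exact mem_insert b C

section Chain

variable {P : Measure Ω} {C : Set {A : Set Ω // MeasurableSet A}}

/-- If the chain orders the two sets the other way, they have equal measure and so agree almost
everywhere. -/
lemma aeSubset_of_measure_le [IsFiniteMeasure P] (hC : IsMaxChain (AESubset P) C)
    {A B : {A : Set Ω // MeasurableSet A}} (hA : A ∈ C) (hB : B ∈ C) (h : P A.1 ≤ P B.1) :
    AESubset P A B := by
  by_cases hAB : A = B
  · exact AESubset.of_subset (by rw [hAB])
  rcases hC.1 hA hB hAB with h' | h'
  · exact h'
  · exact (ae_eq_of_ae_subset_of_measure_ge h' h B.2.nullMeasurableSet (measure_ne_top _ _)).symm.le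

/-- A countable union of members whose measures approach the supremum is comparable with every
member, so maximality puts it in the chain. -/
lemma exists_chain_measure_eq_sSup [IsFiniteMeasure P] (hC : IsMaxChain (AESubset P) C)
    {S : Set ENNReal} (hS : S.Nonempty) (hSC : ∀ s ∈ S, ∃ A ∈ C, P A.1 = s) :
    ∃ B ∈ C, P B.1 = sSup S := by
  obtain ⟨u, humono, hu, huS⟩ := exists_seq_tendsto_sSup hS (OrderTop.bddAbove S)
  choose A hAC hAu using fun n => hSC (u n) (huS n)
  let B : {A : Set Ω // MeasurableSet A} := ⟨⋃ n, (A n).1, MeasurableSet.iUnion fun n => (A n).2⟩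
  refine ⟨B, mem_maxChain_of_comparable hC fun D hD => ?_, le_antisymm ?_ ?_⟩
  · by_cases h : ∃ n, P D.1 ≤ P (A n).1
    · obtain ⟨n, hn⟩ := h
      exact Or.inr ((aeSubset_of_measure_le hC hD (hAC n) hn).trans
        (AESubset.of_subset (subset_iUnion (fun n => (A n).1) n)))
    · push Not at h
      refine Or.inl ?_
      have h2 : ∀ᵐ ω ∂P, ∀ n, ω ∈ (A n).1 → ω ∈ D.1 :=
        ae_all_iff.2 fun n => aeSubset_of_measure_le hC (hAC n) hD (h n).le
      filter_upwards [h2] with ω hω hωB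
      obtain ⟨n, hn⟩ := mem_iUnion.1 hωB
      exact hω n hn
  · change P (⋃ n, (A n).1) ≤ _
    -- The `A n` increase only up to null sets, so the partial unions are compared with `A n` almost
    -- everywhere.
    rw [measure_iUnion_eq_iSup_accumulate]
    refine iSup_le fun n => ?_
    have h2 : ∀ᵐ ω ∂P, ∀ i, i ≤ n → ω ∈ (A i).1 → ω ∈ (A n).1 := by
      refine ae_all_iff.2 fun i => ?_
      by_cases hi : i ≤ n
      · have := aeSubset_of_measure_le hC (hAC i) (hAC n) (by rw [hAu, hAu]; exact humono hi)
        filter_upwards [this] with ω hω _ using hω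
      · exact Filter.Eventually.of_forall fun ω h => absurd h hi
    calc P (accumulate (fun n => (A n).1) n) ≤ P (A n).1 := by
          refine measure_mono_ae ?_
          filter_upwards [h2] with ω hω hωB
          obtain ⟨i, hi, hω'⟩ := mem_accumulate.1 hωB
          exact hω i hi hω'
      _ = u n := hAu n
      _ ≤ sSup S := le_sSup (huS n)
  · refine le_of_tendsto' hu fun n => ?_
    rw [← hAu n]
    exact measure_mono (subset_iUnion (fun n => (A n).1) n)

lemma exists_chain_measure_eq_sInf [IsFiniteMeasure P] (hC : IsMaxChain (AESubset P) C)
    {S : Set ENNReal} (hS : S.Nonempty) (hSC : ∀ s ∈ S, ∃ A ∈ C, P A.1 = s) :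
    ∃ B ∈ C, P B.1 = sInf S := by
  obtain ⟨u, humono, hu, huS⟩ := exists_seq_tendsto_sInf hS (OrderBot.bddBelow S)
  choose A hAC hAu using fun n => hSC (u n) (huS n)
  let B : {A : Set Ω // MeasurableSet A} := ⟨⋂ n, (A n).1, MeasurableSet.iInter fun n => (A n).2⟩
  refine ⟨B, mem_maxChain_of_comparable hC fun D hD => ?_, le_antisymm ?_ ?_⟩
  · by_cases h : ∃ n, P (A n).1 ≤ P D.1
    · obtain ⟨n, hn⟩ := h
      exact Or.inl ((AESubset.of_subset (iInter_subset (fun n => (A n).1) n)).trans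
        (aeSubset_of_measure_le hC (hAC n) hD hn))
    · push Not at h
      refine Or.inr ?_
      have h2 : ∀ᵐ ω ∂P, ∀ n, ω ∈ D.1 → ω ∈ (A n).1 :=
        ae_all_iff.2 fun n => aeSubset_of_measure_le hC hD (hAC n) (h n).le
      filter_upwards [h2] with ω hω hωB
      exact mem_iInter.2 fun n => hω n hωB
  · refine ge_of_tendsto' hu fun n => ?_
    rw [← hAu n]
    exact measure_mono (iInter_subset (fun n => (A n).1) n)
  · change _ ≤ P (⋂ n, (A n).1)
    rw [measure_iInter_eq_iInf_measure_iInter_le (fun n => (A n).2.nullMeasurableSet)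
      ⟨0, measure_ne_top _ _⟩]
    refine le_iInf fun n => ?_
    have h2 : ∀ᵐ ω ∂P, ∀ i, i ≤ n → ω ∈ (A n).1 → ω ∈ (A i).1 := by
      refine ae_all_iff.2 fun i => ?_
      by_cases hi : i ≤ n
      · have := aeSubset_of_measure_le hC (hAC n) (hAC i) (by rw [hAu, hAu]; exact humono hi)
        filter_upwards [this] with ω hω _ using hω
      · exact Filter.Eventually.of_forall fun ω h => absurd h hi
    calc sInf S ≤ u n := sInf_le (huS n)
      _ = P (A n).1 := (hAu n).symm
      _ ≤ _ := by
          refine measure_mono_ae ?_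
          filter_upwards [h2] with ω hω hωB
          exact mem_iInter₂.2 fun i hi => hω i hi hωB

/-- In an atomless finite measure space, a maximal chain of measurable sets attains every value. -/
lemma exists_chain_measure_eq [IsFiniteMeasure P] (hP : Atomless P)
    (hC : IsMaxChain (AESubset P) C) {t : ENNReal} (ht : t ≤ P univ) :
    ∃ A ∈ C, P A.1 = t := by
  have hempty : (⟨∅, MeasurableSet.empty⟩ : {A : Set Ω // MeasurableSet A}) ∈ C :=
    mem_maxChain_of_comparable hC fun D _ => Or.inl (AESubset.of_subset (empty_subset _))
  have huniv : (⟨univ, MeasurableSet.univ⟩ : {A : Set Ω // MeasurableSet A}) ∈ C :=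
    mem_maxChain_of_comparable hC fun D _ => Or.inr (AESubset.of_subset (subset_univ _))
  obtain ⟨B, hBC, hB⟩ := exists_chain_measure_eq_sSup hC
    (S := {s | s ≤ t ∧ ∃ A ∈ C, P A.1 = s}) ⟨0, zero_le, _, hempty, measure_empty⟩
    (fun s hs => hs.2)
  obtain ⟨B', hBC', hB'⟩ := exists_chain_measure_eq_sInf hC
    (S := {s | t ≤ s ∧ ∃ A ∈ C, P A.1 = s}) ⟨P univ, ht, _, huniv, rfl⟩
    (fun s hs => hs.2)
  have hBt : P B.1 ≤ t := hB ▸ sSup_le fun s hs => hs.1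
  have hBt' : t ≤ P B'.1 := hB' ▸ le_sInf fun s hs => hs.1
  have hlow : ∀ D ∈ C, P D.1 ≤ t → P D.1 ≤ P B.1 := fun D hD h =>
    hB ▸ le_sSup ⟨h, D, hD, rfl⟩
  have hupp : ∀ D ∈ C, t ≤ P D.1 → P B'.1 ≤ P D.1 := fun D hD h =>
    hB' ▸ sInf_le ⟨h, D, hD, rfl⟩
  -- `B` and `B'` realise the largest measure ≤ t and the smallest ≥ t in the chain. If t is missed,
  -- atomlessness splits `B' \ B`, and adding the piece `E` to `B` gives a chain member strictly
  -- between.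
  by_contra! hne
  have hlt : P B.1 < t := lt_of_le_of_ne hBt (hne B hBC)
  have hsub : AESubset P B B' := aeSubset_of_measure_le hC hBC hBC' (hBt.trans hBt')
  have hdiff : P B.1 + P (B'.1 \ B.1) = P B'.1 := by
    rw [← measure_union disjoint_sdiff_right (B'.2.diff B.2), union_sdiff_self]
    refine measure_congr ?_
    filter_upwards [hsub] with ω hω
    exact propext ⟨fun h => h.elim hω id, Or.inr⟩
  have hpos : 0 < P (B'.1 \ B.1) := by
    rw [pos_iff_ne_zero]
    intro h0
    rw [h0, add_zero] at hdiff
    exact absurd (hBt'.trans hdiff.symm.le) (not_le.2 hlt)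
  obtain ⟨E, hEsub, hEm, hE0, hElt⟩ := hP _ (B'.2.diff B.2) hpos
  let G : {A : Set Ω // MeasurableSet A} := ⟨B.1 ∪ E, B.2.union hEm⟩
  have hPG : P G.1 = P B.1 + P E :=
    measure_union (disjoint_sdiff_right.mono_right hEsub) hEm
  have hGB' : AESubset P G B' := by
    filter_upwards [hsub] with ω hω h
    exact Or.elim h hω fun h => (hEsub h).1
  have hGC : G ∈ C := by
    refine mem_maxChain_of_comparable hC fun D hD => ?_
    rcases le_total (P D.1) t with h | h
    · exact Or.inr ((aeSubset_of_measure_le hC hD hBC (hlow D hD h)).trans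
        (AESubset.of_subset subset_union_left))
    · exact Or.inl (hGB'.trans (aeSubset_of_measure_le hC hBC' hD (hupp D hD h)))
  rcases le_total (P G.1) t with h | h
  · refine absurd (hlow G hGC h) (not_le.2 ?_)
    rw [hPG]
    exact ENNReal.lt_add_right (measure_ne_top _ _) hE0.ne'
  · refine absurd (hupp G hGC h) (not_le.2 ?_)
    rw [hPG, ← hdiff]
    exact ENNReal.add_lt_add_left (measure_ne_top _ _) hElt

end Chain

/-! ### A uniform random variable -/

/-- Lebesgue measure on the open unit interval. -/
def unitLebesgue : Measure ℝ := volume.restrict (Ioo 0 1)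

instance : IsProbabilityMeasure unitLebesgue := ⟨by simp [unitLebesgue]⟩

/-- An atomless probability space carries a uniformly distributed random variable. -/
theorem exists_uniform {P : Measure Ω} [IsProbabilityMeasure P] (hP : Atomless P) :
    ∃ U : Ω → ℝ, MeasurePreserving U P unitLebesgue := by
  let C := maxChain (AESubset P)
  have hC : IsMaxChain (AESubset P) C := maxChain_spec
  have key : ∀ t : ℝ, t ≤ 1 → ∃ A ∈ C, P A.1 = ENNReal.ofReal t := fun t ht =>
    exists_chain_measure_eq hP hC (by simpa using ht)
  let I := {r : ℚ // 0 ≤ r ∧ r ≤ 1}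
  choose A hAC hA using fun r : I => key (r.1 : ℝ) (by exact_mod_cast r.2.2)
  classical
  let f : I → Ω → ℝ := fun r ω => if ω ∈ (A r).1 then (r.1 : ℝ) else 1
  have hf0 : ∀ r ω, 0 ≤ f r ω := fun r ω => by
    have : (0 : ℝ) ≤ r.1 := by exact_mod_cast r.2.1
    simp only [f]; split_ifs <;> linarith
  have hf1 : ∀ r ω, f r ω ≤ 1 := fun r ω => by
    have : (r.1 : ℝ) ≤ 1 := by exact_mod_cast r.2.2
    simp only [f]; split_ifs <;> linarith
  have : Nonempty I := ⟨⟨0, by norm_num⟩⟩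
  -- `U` is the time at which ω enters the chain: for x ≤ 1, {U < x} is the union of the `A r` with
  -- r < x.
  let U : Ω → ℝ := fun ω => ⨅ r, f r ω
  have hbdd : ∀ ω, BddBelow (range fun r => f r ω) := fun ω =>
    ⟨0, by rintro _ ⟨r, rfl⟩; exact hf0 r ω⟩
  have hU0 : ∀ ω, 0 ≤ U ω := fun ω => le_ciInf fun r => hf0 r ω
  have hU1 : ∀ ω, U ω ≤ 1 := fun ω => (ciInf_le (hbdd ω) ⟨0, by norm_num⟩).trans (hf1 _ ω)
  have hUlt : ∀ x : ℝ, U ⁻¹' Iio x = ⋃ r, f r ⁻¹' Iio x := fun x => by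
    ext ω
    simp only [mem_preimage, mem_Iio, mem_iUnion]
    exact ciInf_lt_iff (hbdd ω)
  have hfm : ∀ r, Measurable (f r) := fun r =>
    Measurable.ite (A r).2 measurable_const measurable_const
  have hUm : Measurable U := measurable_of_Iio fun x => by
    rw [hUlt]; exact MeasurableSet.iUnion fun r => hfm r measurableSet_Iio
  have hcdf : ∀ x : ℝ, 0 < x → x ≤ 1 → P (U ⁻¹' Iio x) = ENNReal.ofReal x := by
    intro x hx0 hx1
    obtain ⟨T, hTC, hT⟩ := key x hx1
    rw [hUlt]
    refine le_antisymm ?_ ?_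
    · rw [← hT]
      refine measure_mono_ae ?_
      have h2 : ∀ᵐ ω ∂P, ∀ r : I, (r.1 : ℝ) < x → ω ∈ (A r).1 → ω ∈ T.1 := by
        refine ae_all_iff.2 fun r => ?_
        by_cases hr : (r.1 : ℝ) < x
        · have := aeSubset_of_measure_le hC (hAC r) hTC
            (by rw [hA, hT]; exact ENNReal.ofReal_le_ofReal hr.le)
          filter_upwards [this] with ω hω _ using hω
        · exact Filter.Eventually.of_forall fun ω h => absurd h hr
      filter_upwards [h2] with ω hω hωB
      obtain ⟨r, hr⟩ := mem_iUnion.1 hωB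
      by_cases hωr : ω ∈ (A r).1
      · refine hω r ?_ hωr
        simpa only [f, hωr, mem_preimage, mem_Iio, if_true] using hr
      · simp only [f, hωr, mem_preimage, mem_Iio, if_false] at hr
        linarith
    · refine ENNReal.ofReal_le_of_le_toReal ?_
      refine le_of_forall_rat_lt_imp_le fun q hq => ?_
      rcases le_or_gt 0 q with hq0 | hq0
      · let r : I := ⟨q, hq0, by exact_mod_cast (hq.trans_le hx1).le⟩
        refine (ENNReal.ofReal_le_iff_le_toReal (measure_ne_top _ _)).1 ?_
        rw [← hA r]
        refine measure_mono fun ω hω => mem_iUnion.2 ⟨r, ?_⟩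
        simpa only [f, hω, mem_preimage, mem_Iio, if_true] using hq
      · exact le_trans (by exact_mod_cast hq0.le) ENNReal.toReal_nonneg
  refine ⟨U, hUm, Measure.ext_of_Ici _ _ fun x => ?_⟩
  rw [Measure.map_apply hUm measurableSet_Ici, unitLebesgue,
    Measure.restrict_apply measurableSet_Ici]
  rcases le_or_gt x 0 with hx | hx
  · have h1 : Ici x ∩ Ioo 0 1 = Ioo 0 1 := inter_eq_right.2 fun y hy => hx.trans hy.1.le
    have : U ⁻¹' Ici x = univ := eq_univ_of_forall fun ω => hx.trans (hU0 ω)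
    simp [h1, this]
  rcases le_or_gt x 1 with hx1 | hx1
  · have h1 : Ici x ∩ Ioo 0 1 = Ico x 1 := by
      ext y; simp only [mem_inter_iff, mem_Ici, mem_Ioo, mem_Ico]
      exact ⟨fun h => ⟨h.1, h.2.2⟩, fun h => ⟨h.1, hx.trans_le h.1, h.2⟩⟩
    have h2 : U ⁻¹' Ici x = (U ⁻¹' Iio x)ᶜ := by rw [← preimage_compl, compl_Iio]
    rw [h1, h2, prob_compl_eq_one_sub (hUm measurableSet_Iio), hcdf x hx hx1, Real.volume_Ico,
      ENNReal.ofReal_sub _ hx.le, ENNReal.ofReal_one]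
  · have h1 : Ici x ∩ Ioo 0 1 = ∅ := by
      ext y; simp only [mem_inter_iff, mem_Ici, mem_Ioo, mem_empty_iff_false, iff_false]
      intro h; linarith [h.2.2, h.1]
    have h2 : U ⁻¹' Ici x = ∅ := by
      ext ω; simp only [mem_preimage, mem_Ici, mem_empty_iff_false, iff_false, not_le]
      exact (hU1 ω).trans_lt hx1
    simp [h1, h2]

/-! ### Quantile functions -/

/-- The left quantile function of `μ` on `(0, 1)`, extended by the constant `c`. -/
def quantile (μ : Measure ℝ) (c u : ℝ) : ℝ :=
  open Classical in if u ∈ Ioo (0 : ℝ) 1 then sInf {x | u ≤ cdf μ x} else c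

/-- Right continuity of the cdf makes the infimum attained; its limits at ±∞ make the set nonempty
and bounded below. -/
lemma quantile_le_iff (μ : Measure ℝ) (c : ℝ) {u x : ℝ} (hu : u ∈ Ioo (0 : ℝ) 1) :
    quantile μ c u ≤ x ↔ u ≤ cdf μ x := by
  have hne : {x | u ≤ cdf μ x}.Nonempty := by
    obtain ⟨y, hy⟩ := ((tendsto_cdf_atTop μ).eventually (lt_mem_nhds hu.2)).exists
    exact ⟨y, hy.le⟩
  have hbdd : BddBelow {x | u ≤ cdf μ x} := by
    obtain ⟨y, hy⟩ := ((tendsto_cdf_atBot μ).eventually (gt_mem_nhds hu.1)).exists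
    refine ⟨y, fun z hz => le_of_not_gt fun hzy => ?_⟩
    exact absurd (hz.trans (monotone_cdf μ hzy.le)) (not_le.2 hy)
  have hmem : u ≤ cdf μ (sInf {x | u ≤ cdf μ x}) := by
    have hr := ((cdf μ).right_continuous (sInf {x | u ≤ cdf μ x})).mono_left
      (nhdsWithin_mono _ Ioi_subset_Ici_self)
    refine ge_of_tendsto hr ?_
    filter_upwards [self_mem_nhdsWithin] with y hy
    obtain ⟨z, hz, hzy⟩ := exists_lt_of_csInf_lt hne hy
    exact le_trans hz (monotone_cdf μ hzy.le)
  rw [quantile, if_pos hu]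
  exact ⟨fun h => hmem.trans (monotone_cdf μ h), fun h => csInf_le hbdd h⟩

lemma quantile_of_notMem (μ : Measure ℝ) (c : ℝ) {u : ℝ} (hu : u ∉ Ioo (0 : ℝ) 1) :
    quantile μ c u = c := if_neg hu

lemma quantile_monotoneOn (μ : Measure ℝ) (c : ℝ) : MonotoneOn (quantile μ c) (Ioo 0 1) :=
  fun _ hu _ hv huv => (quantile_le_iff μ c hu).2
    (huv.trans ((quantile_le_iff μ c hv).1 le_rfl))

lemma measurable_quantile (μ : Measure ℝ) (c : ℝ) : Measurable (quantile μ c) := by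
  refine measurable_of_Iic fun x => ?_
  have : quantile μ c ⁻¹' Iic x =
      (Ioo 0 1 ∩ Iic (cdf μ x)) ∪ ((Ioo 0 1)ᶜ ∩ {_u | c ≤ x}) := by
    ext u
    by_cases hu : u ∈ Ioo (0 : ℝ) 1
    · simp only [mem_preimage, mem_Iic, quantile_le_iff μ c hu, mem_union, mem_inter_iff, hu,
        mem_compl_iff, true_and, not_true_eq_false, false_and, or_false]
    · simp only [mem_preimage, mem_Iic, quantile_of_notMem μ c hu, mem_union, mem_inter_iff, hu,
        mem_compl_iff, false_and, not_false_eq_true, true_and, false_or, mem_ofPred_eq]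
  rw [this]
  exact (measurableSet_Ioo.inter measurableSet_Iic).union
    (measurableSet_Ioo.compl.inter (MeasurableSet.const _))

/-- Under Lebesgue measure on `(0, 1)` the quantile function of `μ` has law `μ`. -/
lemma measurePreserving_quantile (μ : Measure ℝ) [IsProbabilityMeasure μ] (c : ℝ) :
    MeasurePreserving (quantile μ c) unitLebesgue μ := by
  refine ⟨measurable_quantile μ c, Measure.ext_of_Iic _ _ fun x => ?_⟩
  rw [Measure.map_apply (measurable_quantile μ c) measurableSet_Iic, unitLebesgue,
    Measure.restrict_apply (measurable_quantile μ c measurableSet_Iic), ← ofReal_cdf]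
  have h : quantile μ c ⁻¹' Iic x ∩ Ioo 0 1 = Ioo 0 1 ∩ Iic (cdf μ x) := by
    ext u
    simp only [mem_inter_iff, mem_preimage, mem_Iic]
    exact ⟨fun h => ⟨h.2, (quantile_le_iff μ c h.2).1 h.1⟩,
      fun h => ⟨(quantile_le_iff μ c h.1).2 h.2, h.1⟩⟩
  rw [h]
  refine le_antisymm ?_ ?_
  · calc volume (Ioo 0 1 ∩ Iic (cdf μ x)) ≤ volume (Ioc 0 (cdf μ x)) :=
          measure_mono fun u hu => ⟨hu.1.1, hu.2⟩
      _ = _ := by rw [Real.volume_Ioc, sub_zero]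
  · calc _ = volume (Ioo 0 (cdf μ x)) := by rw [Real.volume_Ioo, sub_zero]
      _ ≤ volume (Ioo 0 1 ∩ Iic (cdf μ x)) := measure_mono fun u hu =>
          ⟨⟨hu.1, hu.2.trans_le (cdf_le_one μ x)⟩, hu.2.le⟩

lemma cdf_map_eq {P : Measure Ω} [IsProbabilityMeasure P] {X : Ω → ℝ} (hX : Measurable X)
    (x : ℝ) : cdf (P.map X) x = P.real {ω | X ω ≤ x} := by
  have := Measure.isProbabilityMeasure_map (μ := P) hX.aemeasurable
  rw [cdf_eq_real, map_measureReal_apply hX measurableSet_Iic]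
  rfl

lemma VaR_eq_quantile {P : Measure Ω} [IsProbabilityMeasure P] {X : Ω → ℝ} (hX : Measurable X)
    (c : ℝ) {u : ℝ} (hu : u ∈ Ioo (0 : ℝ) 1) :
    VaR P u X = (quantile (P.map X) c u : EReal) := by
  refine le_antisymm (sInf_le ⟨_, ?_, rfl⟩) (le_sInf ?_)
  · rw [mem_ofPred_eq, ← cdf_map_eq hX, ← quantile_le_iff _ c hu]
  · rintro _ ⟨x, hx, rfl⟩
    rw [mem_ofPred_eq, ← cdf_map_eq hX, ← quantile_le_iff _ c hu] at hx
    exact EReal.coe_le_coe_iff.2 hx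

lemma VaR_le_VaRPlus (P : Measure Ω) (α : ℝ) (X : Ω → ℝ) : VaR P α X ≤ VaRPlus P α X :=
  sInf_le_sInf (image_mono fun x (hx : α < P.real {ω | X ω ≤ x}) => hx.le)

lemma VaRPlus_le_VaR_of_lt (P : Measure Ω) {α β : ℝ} (h : α < β) (X : Ω → ℝ) :
    VaRPlus P α X ≤ VaR P β X :=
  sInf_le_sInf (image_mono fun _ hx => h.trans_le hx)

lemma integrableOn_quantile {P : Measure Ω} [IsProbabilityMeasure P] {X : Ω → ℝ} (hX : X ∈ L1 P)
    (c : ℝ) : IntegrableOn (quantile (P.map X) c) (Ioo 0 1) := by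
  have := Measure.isProbabilityMeasure_map (μ := P) hX.1.aemeasurable
  have h : Integrable id (P.map X) :=
    (integrable_map_measure aestronglyMeasurable_id hX.1.aemeasurable).2 hX.2
  exact (measurePreserving_quantile (P.map X) c).integrable_comp_of_integrable h

lemma intervalIntegrable_quantile {P : Measure Ω} [IsProbabilityMeasure P] {X : Ω → ℝ}
    (hX : X ∈ L1 P) (c : ℝ) {a b : ℝ} (ha : a ∈ Icc (0 : ℝ) 1) (hb : b ∈ Icc (0 : ℝ) 1) :
    IntervalIntegrable (quantile (P.map X) c) volume a b := by
  have h : IntervalIntegrable (quantile (P.map X) c) volume 0 1 :=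
    (intervalIntegrable_iff_integrableOn_Ioo_of_le zero_le_one).2 (integrableOn_quantile hX c)
  refine h.mono_set ?_
  rw [uIcc_of_le (zero_le_one (α := ℝ))]
  exact uIcc_subset_Icc ha hb

lemma integral_comp_quantile {P : Measure Ω} [IsProbabilityMeasure P] {X : Ω → ℝ}
    (hX : Measurable X) (c : ℝ) {φ : ℝ → ℝ} (hφ : Measurable φ) :
    ∫ u in (0 : ℝ)..1, φ (quantile (P.map X) c u) = ∫ ω, φ (X ω) ∂P := by
  have := Measure.isProbabilityMeasure_map (μ := P) hX.aemeasurable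
  have hq := measurePreserving_quantile (P.map X) c
  rw [intervalIntegral.integral_of_le zero_le_one, integral_Ioc_eq_integral_Ioo,
    ← integral_map hX.aemeasurable hφ.aestronglyMeasurable]
  conv_rhs => rw [← hq.map_eq]
  rw [integral_map hq.measurable.aemeasurable hφ.aestronglyMeasurable, unitLebesgue]

lemma ES_eq_integral_quantile {P : Measure Ω} [IsProbabilityMeasure P] {X : Ω → ℝ}
    (hX : Measurable X) (c : ℝ) {α : ℝ} (h0 : 0 ≤ α) (h1 : α < 1) :
    ES P α X = (((1 - α)⁻¹ * ∫ u in α..1, quantile (P.map X) c u : ℝ) : EReal) := by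
  rw [ES, if_pos h1]
  congr 2
  rw [intervalIntegral.integral_of_le h1.le, intervalIntegral.integral_of_le h1.le,
    integral_Ioc_eq_integral_Ioo, integral_Ioc_eq_integral_Ioo]
  refine setIntegral_congr_fun measurableSet_Ioo fun u hu => ?_
  simp only [VaR_eq_quantile hX c ⟨h0.trans_lt hu.1, hu.2⟩, EReal.toReal_coe]

/-! ### Expected Shortfall is law invariant, dominating and quasi-convex -/

lemma VaR_eq_of_identDistrib {P : Measure Ω} {X Y : Ω → ℝ} (h : IdentDistrib X Y P P) (α : ℝ) :
    VaR P α X = VaR P α Y := by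
  have h' : ∀ x : ℝ, P.real {ω | X ω ≤ x} = P.real {ω | Y ω ≤ x} := fun x =>
    congrArg ENNReal.toReal (h.measure_mem_eq measurableSet_Iic)
  simp only [VaR, h']

lemma ES_eq_of_identDistrib {P : Measure Ω} {X Y : Ω → ℝ} (h : IdentDistrib X Y P P) (α : ℝ) :
    ES P α X = ES P α Y := by
  simp only [ES, VaR_eq_of_identDistrib h]

lemma isLawInvariant_ES (P : Measure Ω) (α : ℝ) (𝒳 : Set (Ω → ℝ)) :
    IsLawInvariant P (fun X : 𝒳 => ES P α X) :=
  fun _ _ h => ES_eq_of_identDistrib h α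

/-- At level 1 the quantile is the essential supremum, and almost sure upper bounds pass to convex
combinations. -/
lemma isQuasiConvex_VaR_one {P : Measure Ω} [IsProbabilityMeasure P] {𝒳 : Set (Ω → ℝ)}
    (h𝒳 : ∀ X ∈ 𝒳, Measurable X) : IsQuasiConvex (fun X : 𝒳 => VaR P 1 X) := by
  have hae : ∀ (X : 𝒳) (x : ℝ), 1 ≤ P.real {ω | (X : Ω → ℝ) ω ≤ x} ↔
      ∀ᵐ ω ∂P, (X : Ω → ℝ) ω ≤ x := by
    intro X x
    have hm : MeasurableSet {ω | (X : Ω → ℝ) ω ≤ x} := h𝒳 X X.2 measurableSet_Iic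
    rw [ae_iff_prob_eq_one (p := fun ω => (X : Ω → ℝ) ω ≤ x) (measurableSet_setOfPred.1 hm)]
    refine ⟨fun h => le_antisymm prob_le_one ?_, fun h => ?_⟩
    · rwa [← ENNReal.ofReal_one, ENNReal.ofReal_le_iff_le_toReal (measure_ne_top _ _)]
    · rw [measureReal_def, h, ENNReal.toReal_one]
  intro X Y Z γ hγ hZ
  refine le_of_forall_gt_imp_ge_of_dense fun v hv => ?_
  obtain ⟨hvX, hvY⟩ := max_lt_iff.1 hv
  obtain ⟨_, ⟨x, hx, rfl⟩, hxv⟩ := sInf_lt_iff.1 hvX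
  obtain ⟨_, ⟨y, hy, rfl⟩, hyv⟩ := sInf_lt_iff.1 hvY
  have hmem : 1 ≤ P.real {ω | (Z : Ω → ℝ) ω ≤ max x y} := by
    refine (hae Z _).2 ?_
    filter_upwards [(hae X x).1 hx, (hae Y y).1 hy] with ω h1 h2
    rw [hZ]
    simp only [Pi.add_apply, Pi.smul_apply, smul_eq_mul]
    have h3 := mul_le_mul_of_nonneg_left (h1.trans (le_max_left x y)) hγ.1
    have h4 := mul_le_mul_of_nonneg_left (h2.trans (le_max_right x y)) (sub_nonneg.2 hγ.2)
    linarith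
  have hle : VaR P 1 Z ≤ ((max x y : ℝ) : EReal) := sInf_le (mem_image_of_mem _ hmem)
  refine hle.trans ?_
  rcases max_choice x y with h | h <;> rw [h]
  exacts [hxv.le, hyv.le]

lemma VaRPlus_le_ES {P : Measure Ω} [IsProbabilityMeasure P] {X : Ω → ℝ} (hX : X ∈ L1 P)
    {α : ℝ} (h0 : 0 ≤ α) (h1 : α < 1) : VaRPlus P α X ≤ ES P α X := by
  have hle : ∀ u ∈ Ioo α 1, VaRPlus P α X ≤ (quantile (P.map X) 0 u : EReal) := fun u hu =>
    (VaRPlus_le_VaR_of_lt P hu.1 X).trans (VaR_eq_quantile hX.1 0 ⟨h0.trans_lt hu.1, hu.2⟩).le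
  rw [ES_eq_integral_quantile hX.1 0 h0 h1]
  generalize VaRPlus P α X = v at hle
  induction v with
  | bot => exact bot_le
  | top =>
    obtain ⟨u, hu⟩ := exists_between h1
    exact absurd (hle u hu) (not_le.2 (EReal.coe_lt_top _))
  | coe v =>
    rw [EReal.coe_le_coe_iff, ← div_eq_inv_mul, le_div_iff₀ (sub_pos.2 h1)]
    have := intervalIntegral.integral_mono_on_of_le_Ioo h1.le
      (intervalIntegrable_const (c := v))
      (intervalIntegrable_quantile hX 0 ⟨h0, h1.le⟩ (right_mem_Icc.2 zero_le_one))
      (fun u hu => EReal.coe_le_coe_iff.1 (hle u hu))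
    rwa [intervalIntegral.integral_const, smul_eq_mul, mul_comm] at this

section RockafellarUryasev

variable {P : Measure Ω} [IsProbabilityMeasure P] {X Y Z : Ω → ℝ} {α : ℝ}

lemma intervalIntegrable_max_quantile (hX : X ∈ L1 P) (t : ℝ) {a b : ℝ}
    (ha : a ∈ Icc (0 : ℝ) 1) (hb : b ∈ Icc (0 : ℝ) 1) :
    IntervalIntegrable (fun u => max (quantile (P.map X) 0 u - t) 0) volume a b := by
  have h := (intervalIntegrable_quantile hX 0 ha hb).sub (intervalIntegrable_const (c := t))
  rw [intervalIntegrable_iff] at h ⊢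
  exact Integrable.pos_part h

/-- Integrate q ≤ t + (q - t)⁺ over [α, 1] and add the nonnegative contribution of [0, α]. -/
lemma integral_quantile_le (hX : X ∈ L1 P) (h0 : 0 ≤ α) (h1 : α < 1) (t : ℝ) :
    ∫ u in α..1, quantile (P.map X) 0 u ≤ (1 - α) * t + ∫ ω, max (X ω - t) 0 ∂P := by
  have hα : α ∈ Icc (0 : ℝ) 1 := ⟨h0, h1.le⟩
  have hz : (0 : ℝ) ∈ Icc (0 : ℝ) 1 := left_mem_Icc.2 zero_le_one
  have ho : (1 : ℝ) ∈ Icc (0 : ℝ) 1 := right_mem_Icc.2 zero_le_one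
  rw [← integral_comp_quantile hX.1 0 (φ := fun x => max (x - t) 0) (by fun_prop),
    ← intervalIntegral.integral_add_adjacent_intervals
      (intervalIntegrable_max_quantile hX t hz hα) (intervalIntegrable_max_quantile hX t hα ho)]
  have h2 : 0 ≤ ∫ u in (0 : ℝ)..α, max (quantile (P.map X) 0 u - t) 0 :=
    intervalIntegral.integral_nonneg h0 fun u _ => le_max_right _ _
  have h3 : ∫ u in α..1, quantile (P.map X) 0 u ≤
      ∫ u in α..1, (t + max (quantile (P.map X) 0 u - t) 0) :=
    intervalIntegral.integral_mono_on h1.le (intervalIntegrable_quantile hX 0 hα ho)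
      ((intervalIntegrable_const (c := t)).add (intervalIntegrable_max_quantile hX t hα ho))
      fun u _ => by linarith [le_max_left (quantile (P.map X) 0 u - t) 0]
  rw [intervalIntegral.integral_add intervalIntegrable_const
    (intervalIntegrable_max_quantile hX t hα ho), intervalIntegral.integral_const,
    smul_eq_mul] at h3
  linarith

/-- At t = q(α), monotonicity makes (q - t)⁺ vanish left of α and equal q - t to its right. -/
lemma exists_integral_quantile_eq (hX : X ∈ L1 P) (h0 : 0 < α) (h1 : α < 1) :
    ∃ t, ∫ u in α..1, quantile (P.map X) 0 u = (1 - α) * t + ∫ ω, max (X ω - t) 0 ∂P := by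
  have hα : α ∈ Icc (0 : ℝ) 1 := ⟨h0.le, h1.le⟩
  have hz : (0 : ℝ) ∈ Icc (0 : ℝ) 1 := left_mem_Icc.2 zero_le_one
  have ho : (1 : ℝ) ∈ Icc (0 : ℝ) 1 := right_mem_Icc.2 zero_le_one
  have hm := quantile_monotoneOn (P.map X) 0
  set t := quantile (P.map X) 0 α with ht
  refine ⟨t, ?_⟩
  rw [← integral_comp_quantile hX.1 0 (φ := fun x => max (x - t) 0) (by fun_prop),
    ← intervalIntegral.integral_add_adjacent_intervals
      (intervalIntegrable_max_quantile hX t hz hα) (intervalIntegrable_max_quantile hX t hα ho)]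
  have h2 : ∫ u in (0 : ℝ)..α, max (quantile (P.map X) 0 u - t) 0 = 0 := by
    rw [intervalIntegral.integral_of_le h0.le, integral_Ioc_eq_integral_Ioo]
    refine setIntegral_eq_zero_of_forall_eq_zero fun u hu => max_eq_right (sub_nonpos.2 ?_)
    exact hm ⟨hu.1, hu.2.trans h1⟩ ⟨h0, h1⟩ hu.2.le
  have h3 : ∫ u in α..1, max (quantile (P.map X) 0 u - t) 0 =
      ∫ u in α..1, (quantile (P.map X) 0 u - t) := by
    rw [intervalIntegral.integral_of_le h1.le, intervalIntegral.integral_of_le h1.le,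
      integral_Ioc_eq_integral_Ioo, integral_Ioc_eq_integral_Ioo]
    refine setIntegral_congr_fun measurableSet_Ioo fun u hu => max_eq_left (sub_nonneg.2 ?_)
    exact hm ⟨h0, h1⟩ ⟨h0.trans hu.1, hu.2⟩ hu.1.le
  rw [h2, h3, intervalIntegral.integral_sub (intervalIntegrable_quantile hX 0 hα ho)
    intervalIntegrable_const, intervalIntegral.integral_const, smul_eq_mul]
  ring

/-- The expression (1 - α)t + E(X - t)⁺ is jointly convex in (t, X): test Z at the mixture of the
optimal s for X and t for Y. -/
lemma integral_quantile_convex (hX : X ∈ L1 P) (hY : Y ∈ L1 P) (hZ : Z ∈ L1 P) {γ : ℝ}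
    (hγ : γ ∈ Icc (0 : ℝ) 1) (h : Z = γ • X + (1 - γ) • Y) (h0 : 0 ≤ α) (h1 : α < 1) :
    ∫ u in α..1, quantile (P.map Z) 0 u ≤
      γ * (∫ u in α..1, quantile (P.map X) 0 u) +
        (1 - γ) * ∫ u in α..1, quantile (P.map Y) 0 u := by
  -- No optimal t need exist at α = 0, but there the integral is the mean, which is linear.
  rcases h0.eq_or_lt with rfl | h0
  · have hid : ∀ {W : Ω → ℝ}, W ∈ L1 P →
        ∫ u in (0 : ℝ)..1, quantile (P.map W) 0 u = ∫ ω, W ω ∂P := fun hW =>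
      integral_comp_quantile hW.1 0 (φ := id) measurable_id
    rw [hid hX, hid hY, hid hZ, h]
    simp only [Pi.add_apply, Pi.smul_apply, smul_eq_mul]
    rw [integral_add (hX.2.const_mul _) (hY.2.const_mul _), integral_const_mul,
      integral_const_mul]
  obtain ⟨s, hs⟩ := exists_integral_quantile_eq hX h0 h1
  obtain ⟨t, ht⟩ := exists_integral_quantile_eq hY h0 h1
  have hXs : Integrable (fun ω => max (X ω - s) 0) P := (hX.2.sub (integrable_const s)).pos_part
  have hYt : Integrable (fun ω => max (Y ω - t) 0) P := (hY.2.sub (integrable_const t)).pos_part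
  have hle := integral_quantile_le hZ h0.le h1 (γ * s + (1 - γ) * t)
  have hmax : ∫ ω, max (Z ω - (γ * s + (1 - γ) * t)) 0 ∂P ≤
      ∫ ω, (γ * max (X ω - s) 0 + (1 - γ) * max (Y ω - t) 0) ∂P := by
    refine integral_mono (hZ.2.sub (integrable_const _)).pos_part
      ((hXs.const_mul _).add (hYt.const_mul _)) fun ω => ?_
    have a1 := mul_le_mul_of_nonneg_left (le_max_left (X ω - s) 0) hγ.1
    have a2 := mul_le_mul_of_nonneg_left (le_max_left (Y ω - t) 0) (sub_nonneg.2 hγ.2)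
    have a3 := mul_nonneg hγ.1 (le_max_right (X ω - s) 0)
    have a4 := mul_nonneg (sub_nonneg.2 hγ.2) (le_max_right (Y ω - t) 0)
    simp only [h, Pi.add_apply, Pi.smul_apply, smul_eq_mul]
    exact max_le (by linarith) (by linarith)
  rw [integral_add (hXs.const_mul _) (hYt.const_mul _), integral_const_mul,
    integral_const_mul] at hmax
  rw [hs, ht]
  linarith

end RockafellarUryasev

lemma isQuasiConvex_ES {P : Measure Ω} [IsProbabilityMeasure P] {𝒳 : Set (Ω → ℝ)}
    (h𝒳 : 𝒳 ⊆ L1 P) {α : ℝ} (h0 : 0 ≤ α) (h1 : α < 1) :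
    IsQuasiConvex (fun X : 𝒳 => ES P α X) := by
  intro X Y Z γ hγ hZ
  have hc := integral_quantile_convex (h𝒳 X.2) (h𝒳 Y.2) (h𝒳 Z.2) hγ hZ h0 h1
  simp only [ES_eq_integral_quantile (h𝒳 X.2).1 0 h0 h1, ES_eq_integral_quantile (h𝒳 Y.2).1 0 h0 h1,
    ES_eq_integral_quantile (h𝒳 Z.2).1 0 h0 h1]
  rw [← EReal.coe_strictMono.monotone.map_max, EReal.coe_le_coe_iff,
    ← mul_max_of_nonneg _ _ (inv_nonneg.2 (sub_nonneg.2 h1.le))]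
  refine mul_le_mul_of_nonneg_left (hc.trans ?_) (inv_nonneg.2 (sub_nonneg.2 h1.le))
  set a := ∫ u in α..1, quantile (P.map (X : Ω → ℝ)) 0 u
  set b := ∫ u in α..1, quantile (P.map (Y : Ω → ℝ)) 0 u
  have h3 := mul_le_mul_of_nonneg_left (le_max_left a b) hγ.1
  have h4 := mul_le_mul_of_nonneg_left (le_max_right a b) (sub_nonneg.2 hγ.2)
  linarith

/-! ### Rotations of the tail and Riemann sums -/

/-- The rotation by `s` of the circle obtained by gluing the ends of `[α, 1)`, extended by the
identity to the left of `α`. -/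
def cyclicShift (α s u : ℝ) : ℝ :=
  if u < α then u else if u < 1 - s then u + s else u + s - (1 - α)

lemma measurable_cyclicShift (α s : ℝ) : Measurable (cyclicShift α s) :=
  Measurable.ite measurableSet_Iio measurable_id
    (Measurable.ite measurableSet_Iio (by fun_prop) (by fun_prop))

lemma volume_inter_Ico_add {A : Set ℝ} (hA : MeasurableSet A) {a b c : ℝ} (hab : a ≤ b)
    (hbc : b ≤ c) :
    volume (A ∩ Ico a c) = volume (A ∩ Ico a b) + volume (A ∩ Ico b c) := by
  rw [← Ico_union_Ico_eq_Ico hab hbc, inter_union_distrib_left]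
  refine measure_union (Disjoint.mono inter_subset_right inter_subset_right ?_)
    (hA.inter measurableSet_Ico)
  exact Ico_disjoint_Ico_same

/-- An interval exchange: [0, α) is fixed, [α, 1 - s) and [1 - s, 1) are translated onto [α + s, 1)
and [α, α + s). -/
lemma measurePreserving_cyclicShift {α s : ℝ} (h0 : 0 ≤ α) (hs : 0 ≤ s) (hs' : s ≤ 1 - α) :
    MeasurePreserving (cyclicShift α s) unitLebesgue unitLebesgue := by
  have hT := measurable_cyclicShift α s
  refine ⟨hT, Measure.ext fun A hA => ?_⟩
  rw [Measure.map_apply hT hA, unitLebesgue, restrict_Ioo_eq_restrict_Ico]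
  rw [Measure.restrict_apply (hT hA), Measure.restrict_apply hA,
    volume_inter_Ico_add (hT hA) h0 (by linarith : α ≤ 1),
    volume_inter_Ico_add (hT hA) (by linarith : α ≤ 1 - s) (by linarith : 1 - s ≤ 1),
    volume_inter_Ico_add hA h0 (by linarith : α ≤ 1),
    volume_inter_Ico_add hA (by linarith : α ≤ α + s) (by linarith : α + s ≤ 1)]
  have e1 : cyclicShift α s ⁻¹' A ∩ Ico 0 α = A ∩ Ico 0 α := by
    ext u
    refine and_congr_left fun hu => ?_
    rw [mem_preimage, cyclicShift, if_pos hu.2]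
  have e2 : cyclicShift α s ⁻¹' A ∩ Ico α (1 - s) =
      (fun u => u + s) ⁻¹' (A ∩ Ico (α + s) 1) := by
    ext u
    have : u ∈ Ico α (1 - s) ↔ u + s ∈ Ico (α + s) 1 := by
      simp only [mem_Ico]; constructor <;> intro h <;> constructor <;> linarith [h.1, h.2]
    rw [preimage_inter, mem_inter_iff, mem_inter_iff, mem_preimage (s := Ico _ _), ← this]
    refine and_congr_left fun hu => ?_
    rw [mem_preimage, cyclicShift, if_neg hu.1.not_gt, if_pos hu.2, mem_preimage]
  have e3 : cyclicShift α s ⁻¹' A ∩ Ico (1 - s) 1 =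
      (fun u => u + (s - (1 - α))) ⁻¹' (A ∩ Ico α (α + s)) := by
    ext u
    have : u ∈ Ico (1 - s) 1 ↔ u + (s - (1 - α)) ∈ Ico α (α + s) := by
      simp only [mem_Ico]; constructor <;> intro h <;> constructor <;> linarith [h.1, h.2]
    rw [preimage_inter, mem_inter_iff, mem_inter_iff, mem_preimage (s := Ico _ _), ← this]
    refine and_congr_left fun hu => ?_
    rw [mem_preimage, cyclicShift, if_neg (by linarith [hu.1] : ¬ u < α), if_neg hu.1.not_gt,
      mem_preimage, add_sub_assoc]
  rw [e1, e2, e3, measure_preimage_add_right, measure_preimage_add_right,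
    add_comm (volume (A ∩ Ico (α + s) 1))]

lemma sum_range_add_mod {M : Type*} [AddCommMonoid M] (f : ℕ → M) (i N : ℕ) [NeZero N] :
    ∑ k ∈ Finset.range N, f ((i + k) % N) = ∑ k ∈ Finset.range N, f k := by
  rw [Finset.sum_range, Finset.sum_range,
    ← Equiv.sum_comp (Equiv.addLeft (Fin.ofNat N i)) (fun k : Fin N => f k)]
  refine Finset.sum_congr rfl fun k _ => ?_
  simp [Fin.val_add]

/-- The average of a monotone function over the orbit of an equidistant rotation of `[α, 1)` is at
least its lower Riemann sum. -/
lemma sum_le_sum_cyclicShift {g : ℝ → ℝ} {α : ℝ} (h1 : α < 1) (hg : MonotoneOn g (Ico α 1))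
    (N : ℕ) [NeZero N] {u : ℝ} (hu : u ∈ Ico α 1) :
    ∑ j ∈ Finset.range N, g (α + j * ((1 - α) / N)) ≤
      ∑ k ∈ Finset.range N, g (cyclicShift α (k * ((1 - α) / N)) u) := by
  have hN : (0 : ℝ) < N := by exact_mod_cast Nat.pos_of_ne_zero (NeZero.ne N)
  set h := (1 - α) / N with hh
  have hpos : 0 < h := div_pos (sub_pos.2 h1) hN
  have hNh : N * h = 1 - α := by rw [hh]; field_simp
  -- `u` lies in the cell number `i`; the k-th rotation moves it to the cell (i + k) mod N, where
  -- `g` is at least its value at the left endpoint.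
  set i := ⌊(u - α) / h⌋₊ with hi
  have hi1 : i * h ≤ u - α := by
    rw [← le_div_iff₀ hpos]; exact Nat.floor_le (div_nonneg (sub_nonneg.2 hu.1) hpos.le)
  have hi2 : u - α < (i + 1) * h := by
    rw [← div_lt_iff₀ hpos]; exact Nat.lt_floor_add_one _
  have hiN : i < N := by
    have : (i : ℝ) * h < N * h := by linarith [hu.2]
    exact_mod_cast lt_of_mul_lt_mul_right this hpos.le
  have hmem : ∀ j : ℕ, j < N → α + j * h ∈ Ico α 1 := fun j hj => by
    have : (j : ℝ) * h < N * h := mul_lt_mul_of_pos_right (by exact_mod_cast hj) hpos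
    exact ⟨by nlinarith [(Nat.cast_nonneg j : (0 : ℝ) ≤ j)], by linarith⟩
  rw [← sum_range_add_mod (fun j => g (α + j * h)) i N]
  refine Finset.sum_le_sum fun k hk => ?_
  have hkN := Finset.mem_range.1 hk
  have hk0 : 0 ≤ (k : ℝ) * h := by positivity
  have hkh : (k : ℝ) * h < N * h := mul_lt_mul_of_pos_right (by exact_mod_cast hkN) hpos
  rcases lt_or_ge (i + k) N with hik | hik
  · have hik' : ((i : ℝ) + 1 + k) * h ≤ N * h :=
      mul_le_mul_of_nonneg_right (by exact_mod_cast (by omega : i + 1 + k ≤ N)) hpos.le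
    have hlt : u < 1 - k * h := by nlinarith
    rw [Nat.mod_eq_of_lt hik, cyclicShift, if_neg hu.1.not_gt, if_pos hlt]
    refine hg (hmem _ hik) ⟨by linarith [hu.1], by linarith⟩ ?_
    push_cast
    linarith
  · have hik' : (N : ℝ) * h ≤ (i + k) * h :=
      mul_le_mul_of_nonneg_right (by exact_mod_cast hik) hpos.le
    have hge : 1 - k * h ≤ u := by linarith
    rw [Nat.mod_eq_sub_mod hik, Nat.mod_eq_of_lt (by omega), cyclicShift, if_neg hu.1.not_gt,
      if_neg hge.not_gt]
    refine hg (hmem _ (by omega)) ⟨by linarith, by linarith [hu.2]⟩ ?_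
    rw [Nat.cast_sub hik]
    push_cast
    linarith

/-- Each node after the first bounds the integral over the cell to its left. The last node is 1 - h,
so nothing is asked of `g` at 1. -/
lemma add_integral_le_sum {g : ℝ → ℝ} {α : ℝ} (h1 : α < 1) (hg : MonotoneOn g (Ico α 1))
    (n : ℕ) {h : ℝ} (hh : h = (1 - α) / (n + 1 : ℕ)) :
    h * g α + ∫ u in α..1 - h, g u ≤ h * ∑ j ∈ Finset.range (n + 1), g (α + j * h) := by
  have hN : (0 : ℝ) < (n + 1 : ℕ) := by positivity
  have hpos : 0 < h := hh ▸ div_pos (sub_pos.2 h1) hN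
  have hNh : (n + 1 : ℕ) * h = 1 - α := by rw [hh]; field_simp
  push_cast at hNh
  have hmono : MonotoneOn (fun x => g (α + h * x)) (Icc (0 : ℝ) (0 + n)) := by
    have hmem : ∀ x ∈ Icc (0 : ℝ) (0 + n), α + h * x ∈ Ico α 1 := fun x hx => by
      have h2 := mul_le_mul_of_nonneg_left hx.2 hpos.le
      have h3 := mul_nonneg hpos.le hx.1
      exact ⟨by linarith, by linarith⟩
    intro x hx y hy hxy
    exact hg (hmem x hx) (hmem y hy) (by nlinarith)
  have hsum := mul_le_mul_of_nonneg_left hmono.integral_le_sum hpos.le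
  have hcv := intervalIntegral.smul_integral_comp_add_mul (a := 0) (b := 0 + n) g h α
  rw [smul_eq_mul] at hcv
  rw [hcv, mul_zero, add_zero, zero_add, (by linarith : α + h * n = 1 - h)] at hsum
  rw [Finset.sum_range_succ', mul_add, Nat.cast_zero, zero_mul, add_zero]
  simp only [zero_add] at hsum
  simp only [mul_comm h] at hsum ⊢
  linarith

/-! ### Minimality of Expected Shortfall -/

lemma convex_L1 (P : Measure Ω) : Convex ℝ (L1 P) := fun _ hX _ hY a b _ _ _ =>
  ⟨(hX.1.const_smul a).add (hY.1.const_smul b), (hX.2.smul a).add (hY.2.smul b)⟩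

lemma convex_L1BddBelow (P : Measure Ω) : Convex ℝ (L1BddBelow P) := by
  rintro X ⟨hX, c, hc⟩ Y ⟨hY, d, hd⟩ a b ha hb hab
  refine ⟨convex_L1 P hX hY ha hb hab, a * c + b * d, ?_⟩
  filter_upwards [hc, hd] with ω h1 h2
  exact add_le_add (mul_le_mul_of_nonneg_left h1 ha) (mul_le_mul_of_nonneg_left h2 hb)

lemma mem_L1_of_identDistrib {P : Measure Ω} {X Y : Ω → ℝ} (hX : X ∈ L1 P) (hY : Measurable Y)
    (h : IdentDistrib X Y P P) : Y ∈ L1 P :=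
  ⟨hY, h.integrable_snd hX.2⟩

lemma mem_L1BddBelow_of_identDistrib {P : Measure Ω} {X Y : Ω → ℝ} (hX : X ∈ L1BddBelow P)
    (hY : Measurable Y) (h : IdentDistrib X Y P P) : Y ∈ L1BddBelow P := by
  obtain ⟨hX, c, hc⟩ := hX
  exact ⟨mem_L1_of_identDistrib hX hY h, c, h.ae_snd measurableSet_Ici hc⟩

/-- This form extends quasi-convexity to averages of N variables through `Convex.sum_mem`. -/
lemma convex_sublevel {S : Type*} {𝒳 : Set (S → ℝ)} (h𝒳 : Convex ℝ 𝒳) {ρ : 𝒳 → EReal}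
    (hρ : IsQuasiConvex ρ) (v : EReal) : Convex ℝ {X | ∃ h : X ∈ 𝒳, ρ ⟨X, h⟩ ≤ v} := by
  rintro X ⟨hX, hXv⟩ Y ⟨hY, hYv⟩ a b ha hb hab
  refine ⟨h𝒳 hX hY ha hb hab, ?_⟩
  refine (hρ ⟨X, hX⟩ ⟨Y, hY⟩ _ a ⟨ha, by linarith⟩ ?_).trans (max_le hXv hYv)
  rw [← eq_sub_of_add_eq' hab]

/-- If `X` is essentially bounded from below or `0 < α`, then the constant extending the quantile
function of `X` can be chosen so as to keep it monotone on `[α, 1)`. -/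
lemma exists_quantile_monotoneOn {P : Measure Ω} [IsProbabilityMeasure P] {X : Ω → ℝ}
    (hX : Measurable X) {α : ℝ} (h0 : 0 ≤ α) (hb : 0 < α ∨ ∃ c : ℝ, ∀ᵐ ω ∂P, c ≤ X ω) :
    ∃ c, MonotoneOn (quantile (P.map X) c) (Ico α 1) := by
  rcases h0.lt_or_eq with h0 | rfl
  · exact ⟨0, (quantile_monotoneOn _ _).mono fun u hu => ⟨h0.trans_le hu.1, hu.2⟩⟩
  obtain ⟨c, hc⟩ := hb.resolve_left (lt_irrefl _)
  -- An essential lower bound `c` serves as the value at 0: the cdf vanishes below `c`, so no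
  -- quantile at a positive level is smaller.
  refine ⟨c, fun u hu v hv huv => ?_⟩
  rcases hu.1.eq_or_lt with rfl | hu0
  · rw [quantile_of_notMem _ _ (fun h => lt_irrefl _ h.1)]
    rcases hv.1.eq_or_lt with rfl | hv0
    · rw [quantile_of_notMem _ _ (fun h => lt_irrefl _ h.1)]
    by_contra! hlt
    have h1 := (quantile_le_iff (P.map X) c ⟨hv0, hv.2⟩).1 le_rfl
    have h2 : P.real {ω | X ω ≤ quantile (P.map X) c v} = 0 := by
      rw [measureReal_eq_zero_iff]
      refine measure_mono_null (fun ω hω => ?_) (ae_iff.1 hc)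
      exact not_le.2 (lt_of_le_of_lt hω hlt)
    rw [cdf_map_eq hX, h2] at h1
    exact absurd h1 (not_le.2 hv0)
  · exact quantile_monotoneOn _ _ ⟨hu0, hu.2⟩ ⟨hu0.trans_le huv, hv.2⟩ huv

/-- Lower bound of a dominating risk measure at `X` through the average of the variables obtained
by rotating the upper `(1 - α)`-tail of `X`. -/
lemma lowerSum_le_of_mem_dominating {P : Measure Ω} [IsProbabilityMeasure P] (hP : Atomless P)
    {𝒳 : Set (Ω → ℝ)} (hconv : Convex ℝ 𝒳)
    (hlaw : ∀ X ∈ 𝒳, ∀ Y : Ω → ℝ, Measurable Y → IdentDistrib X Y P P → Y ∈ 𝒳)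
    {α : ℝ} (h0 : 0 ≤ α) (h1 : α < 1) {ρ : 𝒳 → EReal} (hρ : ρ ∈ dominating P 𝒳 (VaRPlus P α))
    (X : 𝒳) (hX : Measurable (X : Ω → ℝ)) {c : ℝ}
    (hmono : MonotoneOn (quantile (P.map (X : Ω → ℝ)) c) (Ico α 1)) (N : ℕ) [NeZero N] :
    (((N : ℝ)⁻¹ * ∑ j ∈ Finset.range N,
      quantile (P.map (X : Ω → ℝ)) c (α + j * ((1 - α) / N)) : ℝ) : EReal) ≤ ρ X := by
  have hprob := Measure.isProbabilityMeasure_map (μ := P) hX.aemeasurable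
  obtain ⟨hdom, hqc, hli⟩ := hρ
  obtain ⟨U, hU⟩ := exists_uniform hP
  set g := quantile (P.map (X : Ω → ℝ)) c with hg
  have hN : (0 : ℝ) < N := by exact_mod_cast Nat.pos_of_ne_zero (NeZero.ne N)
  set h := (1 - α) / N with hh
  have hpos : 0 < h := div_pos (sub_pos.2 h1) hN
  have hNh : N * h = 1 - α := by rw [hh]; field_simp
  let Y : ℕ → Ω → ℝ := fun k ω => g (cyclicShift α (k * h) (U ω))
  have hY : ∀ k < N, MeasurePreserving (Y k) P (P.map (X : Ω → ℝ)) := fun k hk => by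
    have hkh : (k : ℝ) * h ≤ N * h :=
      mul_le_mul_of_nonneg_right (by exact_mod_cast hk.le) hpos.le
    exact (measurePreserving_quantile _ c).comp
      ((measurePreserving_cyclicShift h0 (by positivity) (by linarith)).comp hU)
  have hYX : ∀ k < N, IdentDistrib (X : Ω → ℝ) (Y k) P P := fun k hk =>
    ⟨hX.aemeasurable, (hY k hk).measurable.aemeasurable, (hY k hk).map_eq.symm⟩
  have hYmem : ∀ k ∈ Finset.range N, Y k ∈ {W | ∃ h : W ∈ 𝒳, ρ ⟨W, h⟩ ≤ ρ X} := fun k hk => by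
    have hk := Finset.mem_range.1 hk
    have hm := hlaw X X.2 (Y k) (hY k hk).measurable (hYX k hk)
    exact ⟨hm, (hli X ⟨Y k, hm⟩ (hYX k hk)).symm.le⟩
  obtain ⟨hZ, hZρ⟩ := (convex_sublevel hconv hqc (ρ X)).sum_mem
    (w := fun _ => (N : ℝ)⁻¹) (fun _ _ => (inv_pos.2 hN).le)
    (by rw [Finset.sum_const, Finset.card_range, nsmul_eq_mul, mul_inv_cancel₀ hN.ne']) hYmem
  -- If x is below the lower sum, the average can be ≤ x only where U is outside [α, 1), an event of
  -- probability at most α; such x do not enter the infimum.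
  refine le_trans (le_trans (le_sInf ?_) (hdom ⟨_, hZ⟩)) hZρ
  rintro _ ⟨x, hx, rfl⟩
  rw [EReal.coe_le_coe_iff]
  by_contra! hlt
  refine not_lt.2 ?_ (show α < P.real _ from hx)
  have hsub : {ω | (∑ k ∈ Finset.range N, (N : ℝ)⁻¹ • Y k) ω ≤ x} ⊆ U ⁻¹' (Ico α 1)ᶜ := by
    intro ω hω hωU
    refine absurd (lt_of_le_of_lt hω hlt) (not_lt.2 ?_)
    rw [Finset.sum_apply]
    simp only [Pi.smul_apply, smul_eq_mul]
    rw [← Finset.mul_sum]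
    exact mul_le_mul_of_nonneg_left (sum_le_sum_cyclicShift h1 hmono N hωU) (inv_pos.2 hN).le
  refine ENNReal.toReal_le_of_le_ofReal h0 ((measure_mono hsub).trans ?_)
  rw [hU.measure_preimage measurableSet_Ico.compl.nullMeasurableSet, unitLebesgue,
    Measure.restrict_apply measurableSet_Ico.compl]
  calc volume ((Ico α 1)ᶜ ∩ Ioo 0 1) ≤ volume (Ioo 0 α) :=
        measure_mono fun u hu => ⟨hu.2.1, not_le.1 fun hαu => hu.1 ⟨hαu, hu.2.2⟩⟩
    _ = ENNReal.ofReal α := by rw [Real.volume_Ioo, sub_zero]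

theorem ES_le_of_mem_dominating_VaRPlus {P : Measure Ω} [IsProbabilityMeasure P]
    (hP : Atomless P) {𝒳 : Set (Ω → ℝ)} (h𝒳 : 𝒳 ⊆ L1 P) (hconv : Convex ℝ 𝒳)
    (hlaw : ∀ X ∈ 𝒳, ∀ Y : Ω → ℝ, Measurable Y → IdentDistrib X Y P P → Y ∈ 𝒳)
    {α : ℝ} (h0 : 0 ≤ α) (h1 : α < 1)
    (hb : 0 < α ∨ ∀ X ∈ 𝒳, ∃ c : ℝ, ∀ᵐ ω ∂P, c ≤ X ω)
    {ρ : 𝒳 → EReal} (hρ : ρ ∈ dominating P 𝒳 (VaRPlus P α)) (X : 𝒳) : ES P α X ≤ ρ X := by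
  have hX := h𝒳 X.2
  obtain ⟨c, hmono⟩ := exists_quantile_monotoneOn hX.1 h0 (hb.imp_right fun h => h X X.2)
  have hα : 0 < 1 - α := sub_pos.2 h1
  rw [ES_eq_integral_quantile hX.1 c h0 h1]
  set g := quantile (P.map (X : Ω → ℝ)) c with hg
  let h : ℕ → ℝ := fun n => (1 - α) / (n + 1 : ℕ)
  have hh : Tendsto h atTop (𝓝 0) :=
    (tendsto_const_div_atTop_nhds_zero_nat (1 - α)).comp (tendsto_add_atTop_nat 1)
  -- With n + 1 rotations the lower sum dominates this expression, whose limit needs only continuity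
  -- of the primitive of `g` at 1.
  have hle : ∀ n, (((1 - α)⁻¹ * (h n * g α + ∫ u in α..1 - h n, g u) : ℝ) : EReal) ≤ ρ X := by
    intro n
    refine le_trans (EReal.coe_le_coe_iff.2 ?_)
      (lowerSum_le_of_mem_dominating hP hconv hlaw h0 h1 hρ X hX.1 hmono (n + 1))
    refine (mul_le_mul_of_nonneg_left (add_integral_le_sum h1 hmono n rfl)
      (inv_pos.2 hα).le).trans (le_of_eq ?_)
    have e : (1 - α)⁻¹ * ((1 - α) / (n + 1 : ℕ)) = ((n + 1 : ℕ) : ℝ)⁻¹ := by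
      rw [mul_div_assoc', inv_mul_cancel₀ hα.ne', one_div]
    rw [← mul_assoc, e]
  suffices hlim : Tendsto (fun n => (1 - α)⁻¹ * (h n * g α + ∫ u in α..1 - h n, g u)) atTop
      (𝓝 ((1 - α)⁻¹ * ∫ u in α..1, g u)) from le_of_tendsto' (EReal.tendsto_coe.2 hlim) hle
  refine Tendsto.const_mul _ ?_
  have hprim : ContinuousOn (fun x => ∫ u in α..x, g u) (uIcc α 1) :=
    intervalIntegral.continuousOn_primitive_interval'
      (intervalIntegrable_quantile hX c ⟨h0, h1.le⟩ (right_mem_Icc.2 zero_le_one)) left_mem_uIcc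
  rw [uIcc_of_le h1.le] at hprim
  have hlim : Tendsto (fun n => 1 - h n) atTop (𝓝[Icc α 1] 1) := by
    refine tendsto_nhdsWithin_iff.2 ⟨by simpa using hh.const_sub 1, Eventually.of_forall fun n => ?_⟩
    have hn : (1 : ℝ) ≤ (n + 1 : ℕ) := by exact_mod_cast Nat.le_add_left 1 n
    have h2 : h n ≤ 1 - α := div_le_self hα.le hn
    have h3 : 0 ≤ h n := by positivity
    exact ⟨by linarith, by linarith⟩
  simpa using (hh.mul_const (g α)).add ((hprim 1 (right_mem_Icc.2 h1.le)).tendsto.comp hlim)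

/-- For 0 < β < α, `VaRPlus` at β is at most `VaR` at α, so ρ dominates `ES` at β, which is
continuous in β. Positivity of β dispenses with a lower bound on X. -/
theorem ES_le_of_mem_dominating_VaR {P : Measure Ω} [IsProbabilityMeasure P]
    (hP : Atomless P) {α : ℝ} (h0 : 0 < α) (h1 : α < 1)
    {ρ : L1 P → EReal} (hρ : ρ ∈ dominating P (L1 P) (VaR P α)) (X : L1 P) :
    ES P α X ≤ ρ X := by
  have hX := X.2
  have hle : ∀ β ∈ Ioo 0 α,
      (((1 - β)⁻¹ * ∫ u in β..1, quantile (P.map (X : Ω → ℝ)) 0 u : ℝ) : EReal) ≤ ρ X := by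
    intro β hβ
    rw [← ES_eq_integral_quantile hX.1 0 hβ.1.le (hβ.2.trans h1)]
    exact ES_le_of_mem_dominating_VaRPlus hP subset_rfl (convex_L1 P)
      (fun X hX Y => mem_L1_of_identDistrib hX) hβ.1.le (hβ.2.trans h1) (Or.inl hβ.1)
      ⟨fun W => (VaRPlus_le_VaR_of_lt P hβ.2 W).trans (hρ.1 W), hρ.2⟩ X
  rw [ES_eq_integral_quantile hX.1 0 h0.le h1]
  have hprim : ContinuousOn (fun x => ∫ u in x..1, quantile (P.map (X : Ω → ℝ)) 0 u)
      (uIcc 0 1) := by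
    refine intervalIntegral.continuousOn_primitive_interval_left ?_
    rw [uIcc_of_le zero_le_one, integrableOn_Icc_iff_integrableOn_Ioo]
    exact integrableOn_quantile hX 0
  rw [uIcc_of_le zero_le_one] at hprim
  have hcont : ContinuousAt
      (fun β => (1 - β)⁻¹ * ∫ u in β..1, quantile (P.map (X : Ω → ℝ)) 0 u) α :=
    ((continuousAt_const.sub continuousAt_id).inv₀ (sub_pos.2 h1).ne').mul
      (hprim.continuousAt (Icc_mem_nhds h0 h1))
  refine le_of_tendsto
    (EReal.tendsto_coe.2 (hcont.tendsto.mono_left (nhdsWithin_le_nhds (s := Iio α)))) ?_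
  filter_upwards [Ioo_mem_nhdsLT h0] with β hβ using hle β hβ

end RiskMeasure

end

theorem theorem6p2 {Ω : Type*} [MeasurableSpace Ω] (P : MeasureTheory.Measure Ω)
    [MeasureTheory.IsProbabilityMeasure P] (hP : RiskMeasure.Atomless P) :
    (∀ α : ℝ, 0 < α → α ≤ 1 →
      IsLeast (RiskMeasure.dominating P (RiskMeasure.L1 P) (RiskMeasure.VaR P α))
        (fun X => RiskMeasure.ES P α X)) ∧
    (∀ α : ℝ, 0 < α → α < 1 →
      IsLeast (RiskMeasure.dominating P (RiskMeasure.L1 P) (RiskMeasure.VaRPlus P α))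
        (fun X => RiskMeasure.ES P α X)) ∧
    (∀ α : ℝ, 0 ≤ α → α < 1 →
      IsLeast (RiskMeasure.dominating P (RiskMeasure.L1BddBelow P) (RiskMeasure.VaRPlus P α))
        (fun X => RiskMeasure.ES P α X)) := by
  open RiskMeasure in
  have hsub : L1BddBelow P ⊆ L1 P := fun _ h => h.1
  refine ⟨fun α h0 h1 => ?_, fun α h0 h1 => ?_, fun α h0 h1 => ?_⟩
  · rcases h1.lt_or_eq with h1 | rfl
    · exact ⟨⟨fun X => (VaR_le_VaRPlus P α X).trans (VaRPlus_le_ES X.2 h0.le h1),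
        isQuasiConvex_ES subset_rfl h0.le h1, isLawInvariant_ES P α _⟩,
        fun ρ hρ X => ES_le_of_mem_dominating_VaR hP h0 h1 hρ X⟩
    -- At level 1 `ES` is the dominated functional itself, so only its quasi-convexity and law
    -- invariance matter.
    · have hES : ∀ X : Ω → ℝ, ES P 1 X = VaR P 1 X := fun X => if_neg (lt_irrefl _)
      refine ⟨⟨fun X => (hES X).ge, ?_, isLawInvariant_ES P 1 _⟩,
        fun ρ hρ X => (hES X).le.trans (hρ.1 X)⟩
      simp only [hES]
      exact isQuasiConvex_VaR_one fun X hX => hX.1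
  · exact ⟨⟨fun X => VaRPlus_le_ES X.2 h0.le h1, isQuasiConvex_ES subset_rfl h0.le h1,
      isLawInvariant_ES P α _⟩,
      fun ρ hρ X => ES_le_of_mem_dominating_VaRPlus hP subset_rfl (convex_L1 P)
        (fun X hX Y => mem_L1_of_identDistrib hX) h0.le h1 (Or.inl h0) hρ X⟩
  · exact ⟨⟨fun X => VaRPlus_le_ES (hsub X.2) h0 h1, isQuasiConvex_ES hsub h0 h1,
      isLawInvariant_ES P α _⟩,
      fun ρ hρ X => ES_le_of_mem_dominating_VaRPlus hP hsub (convex_L1BddBelow P)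
        (fun X hX Y => mem_L1BddBelow_of_identDistrib hX) h0 h1 (Or.inr fun X hX => hX.2) hρ X⟩
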